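/- Let $M$ be a (Hausdorff, paracompact) smooth $n$-manifold. A conic pseudo-Finsler structure on a nonempty open set $\mathcal A\subset TM\setminus 0$ that is invariant under positive scaling and projects onto $M$ is a smooth function $F:\mathcal A\to[0,\infty)$, positively $1$-homogeneous in $y$, whose metric tensor $g=\tfrac12\,\partial_y\partial_y F^2$ is nondegenerate on $\mathcal A$. (For $n\ge 1$ and $M\neq\emptyset$, ordinary Finsler metrics on $TM$ are the case $\mathcal A=TM\setminus 0$.) Let $\beta,\gamma$ be the horizontal map of the Barthel connection and the natural vertical injection, and let $\nabla$ and $D^\circ$ be the Cartan and Berwald connections of $F$. A smooth nowhere vanishing section $\overline\varphi$ over $\mathcal A$ of the pullback of $TM$ (a $\pi$-vector field) is called concurrent with respect to $F$ if, for all $\pi$-vector fields $\overline W$, $$\nabla_{\beta\overline W}\,\overline\varphi=-\overline W=D^\circ_{\beta\overline W}\,\overline\varphi,\qquad \nabla_{\gamma\overline W}\,\overline\varphi=0=D^\circ_{\gamma\overline W}\,\overline\varphi .$$ Let $F$ be a conic pseudo-Finsler structure on $\mathcal A$, let $\overline\varphi$ be a concurrent $\pi$-vector field on $\mathcal A$ with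 respect to $F$, and put $\Phi(x,y)=g_{(x,y)}(\overline\varphi(x,y),y)$. Suppose that $$\widehat F=\frac{F^2}{F-\Phi}\quad\text{on}\quad \mathcal D=\{(x,y)\in\mathcal A:\ F(x,y)>\Phi(x,y)\}$$ is a conic pseudo-Finsler structure on $\mathcal D$ (the $\varphi$-Matsumoto change of $F$). Then the restriction of $\overline\varphi$ to $\mathcal D$ is not a concurrent $\pi$-vector field with respect to $\widehat F$. -/

import Mathlib

open scoped Manifold ContDiff

noncomputable section

namespace FinslerGeom

section Charts

/-! Finsler calculus on a coordinate domain of `TM`.  A point is `z = (x, y)` with `x, y : V`, a tangent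
vector of `TM` at `z` is `X = (X.1, X.2)`, with `ρ X = X.1`, and a `π`-vector field is a map
`V × V → V`.  `L` is the Finsler energy `E = F ^ 2 / 2` in these coordinates. -/

variable {V : Type*} [NormedAddCommGroup V] [NormedSpace ℝ V]

/-- The natural injection `γ` of the pullback bundle into the vertical bundle. -/
def gam (u : V) : V × V := (0, u)

/-- The vertical endomorphism `J = γ ∘ ρ`. -/
def vertEndo (X : V × V) : V × V := gam X.1

/-- The one-form `d_J L = dL ∘ J`. -/
def dJ (L : V × V → ℝ) (z X : V × V) : ℝ := fderiv ℝ L z (vertEndo X)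

/-- The two-form `d d_J L`, evaluated on the constant fields `X` and `Y` (whose bracket is zero). -/
def ddJ (L : V × V → ℝ) (z X Y : V × V) : ℝ :=
  fderiv ℝ (fun w => dJ L w Y) z X - fderiv ℝ (fun w => dJ L w X) z Y

/-- The Finsler metric tensor `g (ρ W, ρ Z) = d d_J L (J W, Z)`. -/
def metric (L : V × V → ℝ) (z : V × V) (u v : V) : ℝ := ddJ L z (gam u) (v, 0)

/-- The geodesic spray `G`: the vector field with `i_G d d_J L = - dL`. It is unique wherever the
metric tensor is nondegenerate. -/
def spray (L : V × V → ℝ) (z : V × V) : V × V :=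
  Classical.epsilon fun S : V × V => ∀ Y : V × V, ddJ L z S Y = -fderiv ℝ L z Y

/-- The Barthel connection `Γ = [J, G]` (Frölicher-Nijenhuis bracket), that is
`Γ X = [J X, G] - J [X, G]`. It is tensorial in `X`, so `X` is extended as a constant field. -/
def barthel (L : V × V → ℝ) (z X : V × V) : V × V :=
  VectorField.lieBracket ℝ (fun _ => vertEndo X) (spray L) z
    - vertEndo (VectorField.lieBracket ℝ (fun _ => X) (spray L) z)

/-- The horizontal projector `h = (I + Γ) / 2`. -/
def horProj (L : V × V → ℝ) (z X : V × V) : V × V := (1 / 2 : ℝ) • (X + barthel L z X)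

/-- The vertical projector `v = (I - Γ) / 2`. -/
def verProj (L : V × V → ℝ) (z X : V × V) : V × V := (1 / 2 : ℝ) • (X - barthel L z X)

/-- The horizontal map `β`, determined by `β ∘ ρ = h`. -/
def bet (L : V × V → ℝ) (z : V × V) (u : V) : V × V := horProj L z (u, 0)

/-- Horizontal Berwald derivative `D°_{β w} Z`, given by `γ (D°_{β w} Z) = v [β w, γ Z]`.
As for the three derivatives below, it is tensorial in `w`, which is extended as a constant
`π`-vector field. -/
def berwaldHor (L : V × V → ℝ) (Z : V × V → V) (z : V × V) (w : V) : V :=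
  (verProj L z (VectorField.lieBracket ℝ (fun p => bet L p w) (fun p => gam (Z p)) z)).2

/-- Vertical Berwald derivative `D°_{γ w} Z = ρ [γ w, β Z]`. -/
def berwaldVer (L : V × V → ℝ) (Z : V × V → V) (z : V × V) (w : V) : V :=
  (VectorField.lieBracket ℝ (fun _ => gam w) (fun p => bet L p (Z p)) z).1

/-- Vertical Cartan derivative `∇_{γ w} Z`: the vector `c` with
`2 g(c, u) = γw · g(Z, u) + g(Z, ρ[βu, γw]) + g(u, ρ[γw, βZ])` for all `u`. -/
def cartanVer (L : V × V → ℝ) (Z : V × V → V) (z : V × V) (w : V) : V :=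
  haveI : Nonempty V := ⟨0⟩
  Classical.epsilon fun c : V => ∀ u : V,
    2 * metric L z c u =
      fderiv ℝ (fun p => metric L p (Z p) u) z (gam w)
      + metric L z (Z z) (VectorField.lieBracket ℝ (fun p => bet L p u) (fun _ => gam w) z).1
      + metric L z u (VectorField.lieBracket ℝ (fun _ => gam w) (fun p => bet L p (Z p)) z).1

/-- Horizontal Cartan derivative `∇_{β w} Z`: the vector `c` with
`2 g(c, u) = βw · g(Z, u) + βZ · g(u, w) - βu · g(w, Z)
  - g(w, ρ[βZ, βu]) + g(Z, ρ[βu, βw]) + g(u, ρ[βw, βZ])` for all `u`. -/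
def cartanHor (L : V × V → ℝ) (Z : V × V → V) (z : V × V) (w : V) : V :=
  haveI : Nonempty V := ⟨0⟩
  Classical.epsilon fun c : V => ∀ u : V,
    2 * metric L z c u =
      fderiv ℝ (fun p => metric L p (Z p) u) z (bet L z w)
      + fderiv ℝ (fun p => metric L p u w) z (bet L z (Z z))
      - fderiv ℝ (fun p => metric L p w (Z p)) z (bet L z u)
      - metric L z w
          (VectorField.lieBracket ℝ (fun p => bet L p (Z p)) (fun p => bet L p u) z).1
      + metric L z (Z z)
          (VectorField.lieBracket ℝ (fun p => bet L p u) (fun p => bet L p w) z).1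
      + metric L z u
          (VectorField.lieBracket ℝ (fun p => bet L p w) (fun p => bet L p (Z p)) z).1

end Charts

section Manifolds

variable {n : ℕ} {M : Type*} [TopologicalSpace M] [ChartedSpace (EuclideanSpace ℝ (Fin n)) M]

/-- The slit tangent bundle. -/
def slit (n : ℕ) (M : Type*) [TopologicalSpace M] [ChartedSpace (EuclideanSpace ℝ (Fin n)) M]
    [IsManifold (𝓡 n) ∞ M] : Set (TangentBundle (𝓡 n) M) := {p | p.2 ≠ 0}

/-- The point `(x, t y)` of the tangent bundle, for `p = (x, y)`. -/
def scale [IsManifold (𝓡 n) ∞ M] (t : ℝ) (p : TangentBundle (𝓡 n) M) :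
    TangentBundle (𝓡 n) M := ⟨p.1, t • p.2⟩

/-- The Finsler metric tensor at `p = (x, y)` on `T_x M`: the Hessian of the energy `F ^ 2 / 2`
along the fibre, at `y`. -/
def fibreMetric [IsManifold (𝓡 n) ∞ M] (F : TangentBundle (𝓡 n) M → ℝ)
    (p : TangentBundle (𝓡 n) M) (u v : TangentSpace (𝓡 n) p.1) : ℝ :=
  deriv (fun s : ℝ => deriv (fun t : ℝ => F ⟨p.1, p.2 + s • u + t • v⟩ ^ 2 / 2) 0) 0

/-- A Finsler structure on the whole tangent bundle. That `d d_J E` has maximal rank means that the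
metric tensor is nondegenerate. -/
structure IsFinsler [IsManifold (𝓡 n) ∞ M] (F : TangentBundle (𝓡 n) M → ℝ) : Prop where
  nonneg : ∀ p, 0 ≤ F p
  cont : Continuous F
  smooth : ContMDiffOn (𝓡 n).tangent 𝓘(ℝ, ℝ) ∞ F (slit n M)
  homog : ∀ p ∈ slit n M, ∀ t : ℝ, 0 < t → F (scale t p) = t * F p
  nondeg : ∀ p ∈ slit n M, ∀ u : TangentSpace (𝓡 n) p.1,
    (∀ v : TangentSpace (𝓡 n) p.1, fibreMetric F p u v = 0) → u = 0

/-- A conic pseudo-Finsler structure on the conic domain `D`: `D` is a nonempty open part of the slit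
tangent bundle, invariant under positive scaling, that projects onto `M`, and `F` is a smooth,
nonnegative, positively 1-homogeneous function on `D` with nondegenerate metric tensor.
(The fibres of `D` need not be connected.) -/
structure IsConicPseudoFinsler [IsManifold (𝓡 n) ∞ M] (D : Set (TangentBundle (𝓡 n) M))
    (F : TangentBundle (𝓡 n) M → ℝ) : Prop where
  nonempty : D.Nonempty
  isOpen : IsOpen D
  subset_slit : D ⊆ slit n M
  conic : ∀ p ∈ D, ∀ t : ℝ, 0 < t → scale t p ∈ D
  proj : ∀ x : M, ∃ p ∈ D, p.1 = x
  nonneg : ∀ p ∈ D, 0 ≤ F p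
  smooth : ContMDiffOn (𝓡 n).tangent 𝓘(ℝ, ℝ) ∞ F D
  homog : ∀ p ∈ D, ∀ t : ℝ, 0 < t → F (scale t p) = t * F p
  nondeg : ∀ p ∈ D, ∀ u : TangentSpace (𝓡 n) p.1,
    (∀ v : TangentSpace (𝓡 n) p.1, fibreMetric F p u v = 0) → u = 0

/-- The slit tangent bundle is open. -/
theorem isOpen_slit [IsManifold (𝓡 n) ∞ M] : IsOpen (slit n M) := by
  rw [isOpen_iff_mem_nhds]
  intro p hp
  let e := trivializationAt (EuclideanSpace ℝ (Fin n)) (TangentSpace (𝓡 n) : M → Type _) p.1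
  have hpe : p ∈ e.source := by
    rw [e.mem_source]
    exact FiberBundle.mem_baseSet_trivializationAt' p.1
  have key : ∀ q ∈ e.source, (e q).2 = 0 ↔ q.2 = 0 := by
    intro q hq
    have hb : q.1 ∈ e.baseSet := e.mem_source.1 hq
    have h1 : (e q).2 = e.linearEquivAt ℝ q.1 hb q.2 := rfl
    rw [h1, LinearEquiv.map_eq_zero_iff]
  have h0 : (e p).2 ≠ 0 := fun h => hp ((key p hpe).1 h)
  have hc : ContinuousAt (fun q => (e q).2) p :=
    continuous_snd.continuousAt.comp (e.toOpenPartialHomeomorph.continuousAt hpe)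
  filter_upwards [hc.eventually_ne h0, e.open_source.mem_nhds hpe] with q hq hqs h
  exact hq ((key q hqs).2 h)

/-- A Finsler structure is a conic pseudo-Finsler structure whose domain is the slit tangent bundle. -/
theorem IsFinsler.isConicPseudoFinsler [IsManifold (𝓡 n) ∞ M] [Nonempty M] (hn : 0 < n)
    {F : TangentBundle (𝓡 n) M → ℝ} (hF : IsFinsler F) : IsConicPseudoFinsler (slit n M) F := by
  have hex : ∀ x : M, ∃ p ∈ slit n M, p.1 = x := fun x =>
    ⟨⟨x, (EuclideanSpace.single (⟨0, hn⟩ : Fin n) (1 : ℝ) : EuclideanSpace ℝ (Fin n))⟩, by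
      intro h
      have h2 : (EuclideanSpace.single (⟨0, hn⟩ : Fin n) (1 : ℝ)) = 0 := h
      simp at h2, rfl⟩
  refine ⟨?_, isOpen_slit, subset_rfl, ?_, hex, fun p _ => hF.nonneg p, hF.smooth, hF.homog,
    hF.nondeg⟩
  · obtain ⟨p, hp, -⟩ := hex (Classical.arbitrary M)
    exact ⟨p, hp⟩
  · intro p hp t ht
    exact smul_ne_zero ht.ne' hp

/-- The point of `TM` with coordinates `z = (x, y)` in the chart of `TM` induced by the chart `e`. -/
def chartPoint [IsManifold (𝓡 n) ∞ M] (e : OpenPartialHomeomorph M (EuclideanSpace ℝ (Fin n)))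
    (z : EuclideanSpace ℝ (Fin n) × EuclideanSpace ℝ (Fin n)) : TangentBundle (𝓡 n) M :=
  ⟨e.symm z.1, mfderiv (𝓡 n) (𝓡 n) e.symm z.1 z.2⟩

/-- The energy `F ^ 2 / 2` in the chart induced by `e`. -/
def chartEnergy [IsManifold (𝓡 n) ∞ M] (e : OpenPartialHomeomorph M (EuclideanSpace ℝ (Fin n)))
    (F : TangentBundle (𝓡 n) M → ℝ)
    (z : EuclideanSpace ℝ (Fin n) × EuclideanSpace ℝ (Fin n)) : ℝ :=
  F (chartPoint e z) ^ 2 / 2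

/-- The components of a `π`-vector field in the chart induced by `e`. -/
def chartField [IsManifold (𝓡 n) ∞ M] (e : OpenPartialHomeomorph M (EuclideanSpace ℝ (Fin n)))
    (φ : ∀ p : TangentBundle (𝓡 n) M, TangentSpace (𝓡 n) p.1)
    (z : EuclideanSpace ℝ (Fin n) × EuclideanSpace ℝ (Fin n)) : EuclideanSpace ℝ (Fin n) :=
  mfderiv (𝓡 n) (𝓡 n) e (e.symm z.1) (φ (chartPoint e z))

/-- `φ` is a concurrent `π`-vector field on `D` for the (conic pseudo-)Finsler structure `F` on `D`: a
smooth, nowhere vanishing section over `D` of the pullback of `TM` with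
`∇_{βW} φ = -W = D°_{βW} φ` and `∇_{γW} φ = 0 = D°_{γW} φ` for the Cartan connection `∇` and the
Berwald connection `D°` of `F`. -/
structure IsConcurrent [IsManifold (𝓡 n) ∞ M] (D : Set (TangentBundle (𝓡 n) M))
    (F : TangentBundle (𝓡 n) M → ℝ)
    (φ : ∀ p : TangentBundle (𝓡 n) M, TangentSpace (𝓡 n) p.1) : Prop where
  smooth : ContMDiffOn (𝓡 n).tangent (𝓡 n).tangent ∞
    (fun p => (⟨p.1, φ p⟩ : TangentBundle (𝓡 n) M)) D
  ne_zero : ∀ p ∈ D, φ p ≠ 0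
  eqns : ∀ e ∈ IsManifold.maximalAtlas (𝓡 n) ∞ M,
    ∀ z : EuclideanSpace ℝ (Fin n) × EuclideanSpace ℝ (Fin n),
    z.1 ∈ e.target → chartPoint e z ∈ D → ∀ w : EuclideanSpace ℝ (Fin n),
      cartanHor (chartEnergy e F) (chartField e φ) z w = -w
      ∧ berwaldHor (chartEnergy e F) (chartField e φ) z w = -w
      ∧ cartanVer (chartEnergy e F) (chartField e φ) z w = 0
      ∧ berwaldVer (chartEnergy e F) (chartField e φ) z w = 0

/-- `Φ = g(φ, η)`, where `η (x, y) = y` is the fundamental `π`-vector field. -/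
def assocForm [IsManifold (𝓡 n) ∞ M] (F : TangentBundle (𝓡 n) M → ℝ)
    (φ : ∀ p : TangentBundle (𝓡 n) M, TangentSpace (𝓡 n) p.1)
    (p : TangentBundle (𝓡 n) M) : ℝ := fibreMetric F p (φ p) p.2

/-- The conic domain `{F > Φ}` inside the domain `A` of `F`. -/
def matsumotoDomain [IsManifold (𝓡 n) ∞ M] (A : Set (TangentBundle (𝓡 n) M))
    (F : TangentBundle (𝓡 n) M → ℝ)
    (φ : ∀ p : TangentBundle (𝓡 n) M, TangentSpace (𝓡 n) p.1) :
    Set (TangentBundle (𝓡 n) M) := {p ∈ A | assocForm F φ p < F p}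

/-- The `φ`-Matsumoto change `F ^ 2 / (F - Φ)` of `F`. -/
def matsumotoChange [IsManifold (𝓡 n) ∞ M] (F : TangentBundle (𝓡 n) M → ℝ)
    (φ : ∀ p : TangentBundle (𝓡 n) M, TangentSpace (𝓡 n) p.1)
    (p : TangentBundle (𝓡 n) M) : ℝ := F p ^ 2 / (F p - assocForm F φ p)

end Manifolds

end FinslerGeom

end

/-! In a chart write L = F²/2, let Z be the components of the field, Z^v = (0, Z) and Z^c = (Z,
dZ(y, 0)). The vertical Berwald equation says that Z has zero vertical derivative, so Z^v and Z^c
are locally the vertical and complete lifts of a vector field on the base; neither depends on the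
Finsler structure. The horizontal equation, contracted with y, gives Z^c = βZ - γη. Horizontal
vectors annihilate L and Euler's relation gives (γη)L = 2L, hence Z^c L = -2L
(`fderiv_completeLift`).

If concurrency held for both structures, the same Z^c would scale both energies: Z^c F = -F where F
≠ 0, and Z^c F̂² = -2F̂². Moreover Φ = Z^v L and the lifts commute, so Z^c Φ = -2Φ
(`fderiv_pairing_completeLift`). Thus F has weight -1 and Φ weight -2, while F²/(F - Φ) must have
weight -1; differentiating F̂²(F - Φ)² = F⁴ along Z^c forces Φ = 0 wherever F ≠ 0. Such points
exist, since an energy vanishing on an open set has zero Hessian. Near one of them, the fibre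
derivative of Φ = 0 is g(Z, ·) = 0, so Z = 0 (`eq_zero_of_pairing`), contradicting that the field
vanishes nowhere. -/

open Filter Topology
noncomputable section
namespace FinslerGeom

/-! ### Homogeneous energies in coordinates and the form d d_J L -/

section ChartCalculus

variable {V : Type*} [NormedAddCommGroup V] [NormedSpace ℝ V]

/-- A smooth function on an open conic subset of `V × V` that is positively 2-homogeneous in the second
variable and has nondegenerate vertical Hessian. -/
structure IsEnergyOn (U : Set (V × V)) (L : V × V → ℝ) : Prop where
  isOpen : IsOpen U
  smooth : ContDiffOn ℝ ∞ L U
  conic : ∀ z ∈ U, ∀ t : ℝ, 0 < t → (z.1, t • z.2) ∈ U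
  homog : ∀ z ∈ U, ∀ t : ℝ, 0 < t → L (z.1, t • z.2) = t ^ 2 * L z
  nondeg : ∀ z ∈ U, ∀ u : V, (∀ v : V, fderiv ℝ (fderiv ℝ L) z (0, u) (0, v) = 0) → u = 0

/-- Euler's relation for functions that are positively homogeneous in the second variable. -/
theorem fderiv_vertical_of_homog {W : Type*} [NormedAddCommGroup W] [NormedSpace ℝ W]
    {f : V × V → W} {z : V × V} (k : ℕ) (hf : DifferentiableAt ℝ f z)
    (h : ∀ t : ℝ, 0 < t → f (z.1, t • z.2) = t ^ k • f z) :
    fderiv ℝ f z (0, z.2) = (k : ℝ) • f z := by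
  have hc : HasDerivAt (fun t : ℝ => ((z.1, t • z.2) : V × V)) (0, z.2) 1 := by
    have h2 : HasDerivAt (fun t : ℝ => t • z.2) ((1 : ℝ) • z.2) 1 :=
      (hasDerivAt_id (1 : ℝ)).smul_const z.2
    rw [one_smul] at h2
    exact (hasDerivAt_const (1 : ℝ) z.1).prodMk h2
  have hz : ((z.1, (1 : ℝ) • z.2) : V × V) = z := by simp
  have h1 : HasDerivAt (fun t : ℝ => f (z.1, t • z.2)) (fderiv ℝ f z (0, z.2)) 1 := by
    have hf' : HasFDerivAt f (fderiv ℝ f z) ((z.1, (1 : ℝ) • z.2) : V × V) := by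
      rw [hz]; exact hf.hasFDerivAt
    exact hf'.comp_hasDerivAt (1 : ℝ) hc
  have h2 : HasDerivAt (fun t : ℝ => t ^ k • f z) ((k : ℝ) • f z) 1 := by
    simpa using (hasDerivAt_pow k (1 : ℝ)).smul_const (f z)
  refine h1.unique (h2.congr_of_eventuallyEq ?_)
  filter_upwards [lt_mem_nhds (zero_lt_one' ℝ)] with t ht using h t ht

/-- The derivative of Euler's relation. -/
theorem fderiv_fderiv_radial {W : Type*} [NormedAddCommGroup W] [NormedSpace ℝ W]
    {f : V × V → W} {z : V × V} (c : ℝ) (hf : DifferentiableAt ℝ f z)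
    (hf' : DifferentiableAt ℝ (fderiv ℝ f) z)
    (h : ∀ᶠ p in 𝓝 z, fderiv ℝ f p (0, p.2) = c • f p) (X : V × V) :
    fderiv ℝ (fderiv ℝ f) z X (0, z.2) + fderiv ℝ f z (0, X.2) = c • fderiv ℝ f z X := by
  have h1 : HasFDerivAt (fun p : V × V => fderiv ℝ f p (0, p.2)) _ z :=
    hf'.hasFDerivAt.clm_apply
      (((ContinuousLinearMap.inr ℝ V V).comp (ContinuousLinearMap.snd ℝ V V)).hasFDerivAt (x := z))
  have h2 : HasFDerivAt (fun p : V × V => c • f p) _ z := hf.hasFDerivAt.const_smul c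
  have h3 := DFunLike.congr_fun (h1.unique (h2.congr_of_eventuallyEq h)) X
  simpa [add_comm] using h3

/-- The vertical endomorphism as a continuous linear map. -/
def vertEndoL (V : Type*) [NormedAddCommGroup V] [NormedSpace ℝ V] : V × V →L[ℝ] V × V :=
  (ContinuousLinearMap.inr ℝ V V).comp (ContinuousLinearMap.fst ℝ V V)

/-- The two-form `d d_J L` as a continuous linear map into the dual, in terms of the Hessian of `L`. -/
def ddJL (D : V × V →L[ℝ] V × V →L[ℝ] ℝ) : V × V →L[ℝ] V × V →L[ℝ] ℝ :=
  ((ContinuousLinearMap.compL ℝ (V × V) (V × V) ℝ).flip (vertEndoL V)).comp D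
    - D.flip.comp (vertEndoL V)

theorem ddJL_apply (D : V × V →L[ℝ] V × V →L[ℝ] ℝ) (X Y : V × V) :
    ddJL D X Y = D X (0, Y.1) - D Y (0, X.1) := rfl

namespace IsEnergyOn

variable {U : Set (V × V)} {L : V × V → ℝ}

theorem contDiffAt (h : IsEnergyOn U L) {z : V × V} (hz : z ∈ U) : ContDiffAt ℝ ∞ L z :=
  h.smooth.contDiffAt (h.isOpen.mem_nhds hz)

theorem differentiableAt (h : IsEnergyOn U L) {z : V × V} (hz : z ∈ U) : DifferentiableAt ℝ L z :=
  (h.contDiffAt hz).differentiableAt (by simp)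

theorem contDiffAt_fderiv (h : IsEnergyOn U L) {z : V × V} (hz : z ∈ U) :
    ContDiffAt ℝ ∞ (fderiv ℝ L) z :=
  (h.contDiffAt hz).fderiv_right (by simp)

theorem contDiffAt_fderiv_fderiv (h : IsEnergyOn U L) {z : V × V} (hz : z ∈ U) :
    ContDiffAt ℝ ∞ (fderiv ℝ (fderiv ℝ L)) z :=
  (h.contDiffAt_fderiv hz).fderiv_right (by simp)

theorem differentiableAt_fderiv (h : IsEnergyOn U L) {z : V × V} (hz : z ∈ U) :
    DifferentiableAt ℝ (fderiv ℝ L) z :=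
  (h.contDiffAt_fderiv hz).differentiableAt (by simp)

theorem hessian_symm (h : IsEnergyOn U L) {z : V × V} (hz : z ∈ U) (X Y : V × V) :
    fderiv ℝ (fderiv ℝ L) z X Y = fderiv ℝ (fderiv ℝ L) z Y X :=
  ((h.contDiffAt hz).isSymmSndFDerivAt (by simpa using WithTop.coe_le_coe.2 (le_top : (2 : ℕ∞) ≤ ⊤))) X Y

theorem euler (h : IsEnergyOn U L) {z : V × V} (hz : z ∈ U) :
    fderiv ℝ L z (0, z.2) = 2 * L z := by
  simpa using fderiv_vertical_of_homog 2 (h.differentiableAt hz)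
    (fun t ht => by simpa using h.homog z hz t ht)

theorem hessian_radial (h : IsEnergyOn U L) {z : V × V} (hz : z ∈ U) (X : V × V) :
    fderiv ℝ (fderiv ℝ L) z X (0, z.2) + fderiv ℝ L z (0, X.2) = 2 * fderiv ℝ L z X :=
  fderiv_fderiv_radial 2 (h.differentiableAt hz) (h.differentiableAt_fderiv hz) (by
    filter_upwards [h.isOpen.mem_nhds hz] with p hp using h.euler hp) X

theorem hessian_radial_vertical (h : IsEnergyOn U L) {z : V × V} (hz : z ∈ U) (v : V) :
    fderiv ℝ (fderiv ℝ L) z (0, v) (0, z.2) = fderiv ℝ L z (0, v) := by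
  have := h.hessian_radial hz (0, v)
  dsimp only at this
  linarith

theorem ddJ_eq (h : IsEnergyOn U L) {z : V × V} (hz : z ∈ U) (X Y : V × V) :
    ddJ L z X Y = ddJL (fderiv ℝ (fderiv ℝ L) z) X Y := by
  have key : ∀ A : V × V, fderiv ℝ (fun w => dJ L w A) z
      = (fderiv ℝ (fderiv ℝ L) z).flip (0, A.1) := by
    intro A
    have h1 := (h.differentiableAt_fderiv hz).hasFDerivAt.clm_apply
      (hasFDerivAt_const ((0, A.1) : V × V) z)
    have h2 : HasFDerivAt (fun w => dJ L w A) _ z := h1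
    rw [h2.fderiv]
    ext <;> simp
  rw [ddJ, key, key, ddJL_apply]
  rfl

/-- The form is block triangular with the metric tensor, up to sign, in both off-diagonal blocks:
vertical test vectors detect X.1, and once X.1 = 0 the vectors (v, 0) detect X.2. -/
theorem ddJL_injective (h : IsEnergyOn U L) {z : V × V} (hz : z ∈ U) :
    Function.Injective (ddJL (fderiv ℝ (fderiv ℝ L) z)) := by
  rw [injective_iff_map_eq_zero]
  intro X hX
  have hX' : ∀ Y, fderiv ℝ (fderiv ℝ L) z X (0, Y.1) - fderiv ℝ (fderiv ℝ L) z Y (0, X.1) = 0 :=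
    fun Y => by rw [← ddJL_apply, hX]; rfl
  have h1 : X.1 = 0 := h.nondeg z hz _ fun v => by
    have := hX' (0, v)
    rw [h.hessian_symm hz]
    have e0 : ((0, (0 : V)) : V × V) = 0 := rfl
    simpa [e0] using this
  have h2 : X.2 = 0 := h.nondeg z hz _ fun v => by
    have := hX' (v, 0)
    have e0 : ((0, (0 : V)) : V × V) = 0 := rfl
    have e1 : X = (0, X.2) := Prod.ext h1 rfl
    rw [h1, e0, map_zero, sub_zero, e1] at this
    exact this
  exact Prod.ext h1 h2

/-! ### The geodesic spray: uniqueness, smoothness and homogeneity -/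

/-- Injectivity removes the ambiguity of the `epsilon` choice, so the spray can be computed by
exhibiting any solution. -/
theorem spray_eq_of (h : IsEnergyOn U L) {z : V × V} (hz : z ∈ U) {S : V × V}
    (hS : ∀ Y, ddJL (fderiv ℝ (fderiv ℝ L) z) S Y = -fderiv ℝ L z Y) : spray L z = S := by
  have hex : ∃ S : V × V, ∀ Y : V × V, ddJ L z S Y = -fderiv ℝ L z Y :=
    ⟨S, fun Y => by rw [h.ddJ_eq hz, hS]⟩
  have h1 : ∀ Y : V × V, ddJ L z (spray L z) Y = -fderiv ℝ L z Y := Classical.epsilon_spec hex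
  apply h.ddJL_injective hz
  refine ContinuousLinearMap.ext fun Y => ?_
  rw [← h.ddJ_eq hz, h1, hS]

theorem fderiv_scale (h : IsEnergyOn U L) {z : V × V} (hz : z ∈ U) {t : ℝ} (ht : 0 < t)
    (X : V × V) : fderiv ℝ L (z.1, t • z.2) (X.1, t • X.2) = t ^ 2 * fderiv ℝ L z X := by
  let A : V × V →L[ℝ] V × V := (ContinuousLinearMap.id ℝ V).prodMap (t • ContinuousLinearMap.id ℝ V)
  have h1 : HasFDerivAt (fun p => L (A p)) ((fderiv ℝ L (A z)).comp A) z :=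
    (h.differentiableAt (h.conic z hz t ht)).hasFDerivAt.comp z A.hasFDerivAt
  have h2 : HasFDerivAt (fun p => t ^ 2 * L p) _ z :=
    (h.differentiableAt hz).hasFDerivAt.const_mul (t ^ 2)
  have h3 := h1.unique (h2.congr_of_eventuallyEq (by
    filter_upwards [h.isOpen.mem_nhds hz] with p hp using h.homog p hp t ht))
  exact DFunLike.congr_fun h3 X

theorem hessian_scale (h : IsEnergyOn U L) {z : V × V} (hz : z ∈ U) {t : ℝ} (ht : 0 < t)
    (X Y : V × V) : fderiv ℝ (fderiv ℝ L) (z.1, t • z.2) (X.1, t • X.2) (Y.1, t • Y.2)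
      = t ^ 2 * fderiv ℝ (fderiv ℝ L) z X Y := by
  let A : V × V →L[ℝ] V × V := (ContinuousLinearMap.id ℝ V).prodMap (t • ContinuousLinearMap.id ℝ V)
  have h1 : HasFDerivAt (fun p => fderiv ℝ L (A p) (A Y)) _ z :=
    ((h.differentiableAt_fderiv (h.conic z hz t ht)).hasFDerivAt.comp z A.hasFDerivAt).clm_apply
      (hasFDerivAt_const (A Y) z)
  have h2 : HasFDerivAt (fun p => t ^ 2 * fderiv ℝ L p Y) _ z :=
    ((h.differentiableAt_fderiv hz).hasFDerivAt.clm_apply (hasFDerivAt_const Y z)).const_mul (t ^ 2)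
  have h3 := h1.unique (h2.congr_of_eventuallyEq (by
    filter_upwards [h.isOpen.mem_nhds hz] with p hp using h.fderiv_scale hp ht Y))
  have h4 := DFunLike.congr_fun h3 X
  simpa [A, Prod.map] using h4

variable [FiniteDimensional ℝ V]

/-- The isomorphism of `V × V` with its dual defined by `d d_J L`. -/
def ddJEquiv (h : IsEnergyOn U L) {z : V × V} (hz : z ∈ U) :
    (V × V) ≃L[ℝ] (V × V →L[ℝ] ℝ) :=
  (LinearEquiv.ofInjectiveOfFinrankEq (ddJL (fderiv ℝ (fderiv ℝ L) z)).toLinearMap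
    (h.ddJL_injective hz) (by
      rw [← (LinearMap.toContinuousLinearMap : (V × V →ₗ[ℝ] ℝ) ≃ₗ[ℝ] _).finrank_eq]
      exact (Subspace.dual_finrank_eq (K := ℝ) (V := V × V)).symm)).toContinuousLinearEquiv

theorem coe_ddJEquiv (h : IsEnergyOn U L) {z : V × V} (hz : z ∈ U) :
    (h.ddJEquiv hz : V × V →L[ℝ] V × V →L[ℝ] ℝ) = ddJL (fderiv ℝ (fderiv ℝ L) z) :=
  rfl

/-- Replaces the pointwise choice by a closed formula, from which smoothness follows because
inversion is smooth at an isomorphism. -/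
theorem spray_eq_inverse (h : IsEnergyOn U L) {z : V × V} (hz : z ∈ U) :
    spray L z = (ddJL (fderiv ℝ (fderiv ℝ L) z)).inverse (-fderiv ℝ L z) := by
  apply h.spray_eq_of hz
  intro Y
  rw [← h.coe_ddJEquiv hz, ContinuousLinearMap.inverse_equiv]
  simp

theorem spray_spec (h : IsEnergyOn U L) {z : V × V} (hz : z ∈ U) (Y : V × V) :
    ddJL (fderiv ℝ (fderiv ℝ L) z) (spray L z) Y = -fderiv ℝ L z Y := by
  rw [h.spray_eq_inverse hz, ← h.coe_ddJEquiv hz, ContinuousLinearMap.inverse_equiv]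
  simp

/-- By the spray equation and Euler's relation, both sides represent the vertical part of dL under
the metric tensor. -/
theorem spray_fst (h : IsEnergyOn U L) {z : V × V} (hz : z ∈ U) : (spray L z).1 = z.2 := by
  rw [← sub_eq_zero]
  apply h.nondeg z hz
  intro v
  have h1 := h.spray_spec hz (0, v)
  rw [ddJL_apply, ← h.hessian_radial_vertical hz v] at h1
  have e0 : ((0, (0 : V)) : V × V) = 0 := rfl
  have e1 : ((0, (spray L z).1 - z.2) : V × V) = (0, (spray L z).1) - (0, z.2) := by simp
  rw [e1, h.hessian_symm hz, map_sub]
  simp only [e0, map_zero, zero_sub] at h1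
  linarith

theorem contDiffAt_spray (h : IsEnergyOn U L) {z : V × V} (hz : z ∈ U) :
    ContDiffAt ℝ ∞ (spray L) z := by
  have hflip : ContDiff ℝ ∞ (fun D : V × V →L[ℝ] V × V →L[ℝ] ℝ => D.flip) :=
    ContinuousLinearMap.contDiff (𝕜 := ℝ) (E := V × V →L[ℝ] V × V →L[ℝ] ℝ)
      (F := V × V →L[ℝ] V × V →L[ℝ] ℝ)
      (ContinuousLinearMap.flipₗᵢ ℝ (V × V) (V × V) ℝ).toContinuousLinearEquiv
  have h1 : ContDiffAt ℝ ∞ (fun p => ddJL (fderiv ℝ (fderiv ℝ L) p)) z :=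
    (contDiffAt_const.clm_comp (h.contDiffAt_fderiv_fderiv hz)).sub
      ((hflip.contDiffAt.comp z (h.contDiffAt_fderiv_fderiv hz)).clm_comp contDiffAt_const)
  have h2 : ContDiffAt ℝ ∞ (fun p => (ddJL (fderiv ℝ (fderiv ℝ L) p)).inverse) z := by
    have h3 := contDiffAt_map_inverse (𝕜 := ℝ) (n := ∞) (h.ddJEquiv hz)
    rw [h.coe_ddJEquiv hz] at h3
    exact h3.comp z h1
  refine (h2.clm_apply (h.contDiffAt_fderiv hz).neg).congr_of_eventuallyEq ?_
  filter_upwards [h.isOpen.mem_nhds hz] with p hp using h.spray_eq_inverse hp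

theorem differentiableAt_spray (h : IsEnergyOn U L) {z : V × V} (hz : z ∈ U) :
    DifferentiableAt ℝ (spray L) z :=
  (h.contDiffAt_spray hz).differentiableAt (by simp)

theorem spray_scale (h : IsEnergyOn U L) {z : V × V} (hz : z ∈ U) {t : ℝ} (ht : 0 < t) :
    spray L (z.1, t • z.2) = (t • (spray L z).1, t ^ 2 • (spray L z).2) := by
  apply h.spray_eq_of (h.conic z hz t ht)
  intro Y
  -- The fibre dilation is onto, so the test vector may be taken in its image, where the scaling
  -- laws of dL and of the Hessian apply.
  obtain ⟨Y, rfl⟩ : ∃ Z : V × V, Y = (Z.1, t • Z.2) :=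
    ⟨(Y.1, t⁻¹ • Y.2), by simp [smul_smul, ht.ne']⟩
  have e1 : ((t • (spray L z).1, t ^ 2 • (spray L z).2) : V × V)
      = t • ((spray L z).1, t • (spray L z).2) := by
    simp [smul_smul, pow_two]
  have e2 : ((0, Y.1) : V × V) = t⁻¹ • ((0, t • Y.1) : V × V) := by
    simp [smul_smul, ht.ne']
  have h1 := h.hessian_scale hz ht (spray L z) (0, Y.1)
  have h2 := h.hessian_scale hz ht Y (0, (spray L z).1)
  have h3 := h.spray_spec hz Y
  rw [ddJL_apply] at h3 ⊢
  rw [h.fderiv_scale hz ht, e1]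
  dsimp only at h1 h2 ⊢
  rw [e2]
  simp only [map_smul, smul_apply, smul_eq_mul]
  dsimp only [Prod.smul_mk, Prod.fst]
  rw [h1, h2]
  field_simp
  linear_combination h3

theorem fderiv_spray_radial (h : IsEnergyOn U L) {z : V × V} (hz : z ∈ U) :
    fderiv ℝ (fun p => (spray L p).2) z (0, z.2) = (2 : ℝ) • (spray L z).2 := by
  simpa using fderiv_vertical_of_homog 2 (h.differentiableAt_spray hz).snd
    (fun t ht => by rw [h.spray_scale hz ht])

theorem contDiffAt_spray_snd (h : IsEnergyOn U L) {z : V × V} (hz : z ∈ U) :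
    ContDiffAt ℝ ∞ (fun p => (spray L p).2) z :=
  (h.contDiffAt_spray hz).snd

theorem differentiableAt_fderiv_spray_snd (h : IsEnergyOn U L) {z : V × V} (hz : z ∈ U) :
    DifferentiableAt ℝ (fderiv ℝ (fun p => (spray L p).2)) z :=
  ((h.contDiffAt_spray_snd hz).fderiv_right (m := ∞) (by simp)).differentiableAt (by simp)

/-- This collapses the second-order term of the horizontal Berwald derivative when it is contracted
with y. -/
theorem fderiv_fderiv_spray_radial (h : IsEnergyOn U L) {z : V × V} (hz : z ∈ U) (v : V) :
    fderiv ℝ (fderiv ℝ (fun p => (spray L p).2)) z (0, v) (0, z.2)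
      = fderiv ℝ (fun p => (spray L p).2) z (0, v) := by
  have h1 := fderiv_fderiv_radial 2 (h.differentiableAt_spray hz).snd
    (h.differentiableAt_fderiv_spray_snd hz) (by
      filter_upwards [h.isOpen.mem_nhds hz] with p hp using h.fderiv_spray_radial hp) (0, v)
  rw [two_smul] at h1
  exact add_right_cancel h1

theorem fderiv_spray (h : IsEnergyOn U L) {z : V × V} (hz : z ∈ U) (X : V × V) :
    fderiv ℝ (spray L) z X = (X.2, fderiv ℝ (fun p => (spray L p).2) z X) := by
  have h1 : HasFDerivAt (fun p : V × V => (p.2, (spray L p).2)) _ z :=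
    hasFDerivAt_snd.prodMk (h.differentiableAt_spray hz).snd.hasFDerivAt
  rw [(h1.congr_of_eventuallyEq (f₁ := spray L) (by
    filter_upwards [h.isOpen.mem_nhds hz] with p hp using Prod.ext (h.spray_fst hp) rfl)).fderiv]
  rfl

/-! ### The Barthel connection and the Berwald derivatives in coordinates -/

theorem barthel_eq (h : IsEnergyOn U L) {z : V × V} (hz : z ∈ U) (X : V × V) :
    barthel L z X = (X.1, fderiv ℝ (fun p => (spray L p).2) z (0, X.1) - X.2) := by
  simp [barthel, VectorField.lieBracket, vertEndo, gam, h.fderiv_spray hz]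

theorem bet_eq (h : IsEnergyOn U L) {z : V × V} (hz : z ∈ U) (u : V) :
    bet L z u = (u, (1 / 2 : ℝ) • fderiv ℝ (fun p => (spray L p).2) z (0, u)) := by
  simp only [bet, horProj, h.barthel_eq hz, Prod.mk_add_mk, Prod.smul_mk, sub_zero, zero_add]
  rw [← two_smul ℝ u, smul_smul]
  norm_num

theorem verProj_vertical (h : IsEnergyOn U L) {z : V × V} (hz : z ∈ U) (u : V) :
    verProj L z (0, u) = (0, u) := by
  have e0 : ((0, (0 : V)) : V × V) = 0 := rfl
  simp only [verProj, h.barthel_eq hz, e0, map_zero, zero_sub, Prod.mk_sub_mk, sub_neg_eq_add,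
    Prod.smul_mk]
  rw [← two_smul ℝ u, smul_smul]
  norm_num

/-- The spray is tangent to the level sets of the energy. -/
theorem fderiv_apply_spray (h : IsEnergyOn U L) {z : V × V} (hz : z ∈ U) :
    fderiv ℝ L z (spray L z) = 0 := by
  have := h.spray_spec hz (spray L z)
  rw [ddJL_apply] at this
  linarith

/-- The energy is constant along horizontal vectors. -/
theorem fderiv_bet (h : IsEnergyOn U L) {z : V × V} (hz : z ∈ U) (u : V) :
    fderiv ℝ L z (bet L z u) = 0 := by
  have h1 : HasFDerivAt (fun p => fderiv ℝ L p (spray L p)) _ z :=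
    (h.differentiableAt_fderiv hz).hasFDerivAt.clm_apply (h.differentiableAt_spray hz).hasFDerivAt
  have h2 := h1.unique ((hasFDerivAt_const (0 : ℝ) z).congr_of_eventuallyEq (by
    filter_upwards [h.isOpen.mem_nhds hz] with p hp using h.fderiv_apply_spray hp))
  -- The vertical derivative of dL(S) = 0 is d²L((0, u), S) + dL(u, d) = 0. The spray equation and
  -- Euler's relation turn the first term into dL(u, 0), and (u, d) + (u, 0) is twice βu.
  have h3 := DFunLike.congr_fun h2 (0, u)
  simp [h.fderiv_spray hz] at h3
  have h4 := h.spray_spec hz (u, 0)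
  rw [ddJL_apply, h.spray_fst hz] at h4
  have h5 := h.hessian_radial hz (u, 0)
  have h6 := h.hessian_symm hz (0, u) (spray L z)
  have e0 : ((0, (0 : V)) : V × V) = 0 := rfl
  simp only [e0, map_zero] at h5
  dsimp only at h4
  set d := fderiv ℝ (fun p => (spray L p).2) z (0, u)
  have e1 : bet L z u = (1 / 2 : ℝ) • ((u, d) + (u, 0)) := by
    rw [h.bet_eq hz]
    simp only [Prod.mk_add_mk, Prod.smul_mk, add_zero]
    rw [← two_smul ℝ u, smul_smul]
    norm_num [d]
  rw [e1, map_smul, map_add, smul_eq_mul]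
  linarith

theorem berwaldVer_eq (h : IsEnergyOn U L) {z : V × V} (hz : z ∈ U) {Z : V × V → V}
    (hZ : DifferentiableAt ℝ Z z) (w : V) : berwaldVer L Z z w = fderiv ℝ Z z (0, w) := by
  have h1 : HasFDerivAt (fun p : V × V =>
      ((Z p, (1 / 2 : ℝ) • fderiv ℝ (fun p => (spray L p).2) p (0, Z p)) : V × V)) _ z :=
    hZ.hasFDerivAt.prodMk (((h.differentiableAt_fderiv_spray_snd hz).hasFDerivAt.clm_apply
      ((hasFDerivAt_const (0 : V) z).prodMk hZ.hasFDerivAt)).const_smul (1 / 2 : ℝ))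
  have h2 := (h1.congr_of_eventuallyEq (f₁ := fun p => bet L p (Z p)) (by
    filter_upwards [h.isOpen.mem_nhds hz] with p hp using h.bet_eq hp _)).fderiv
  simp [berwaldVer, VectorField.lieBracket, h2, gam]

/-- The bracket [βw, γZ] is already vertical, so the projector fixes it; the correction term comes
from differentiating βw along γZ. -/
theorem berwaldHor_eq (h : IsEnergyOn U L) {z : V × V} (hz : z ∈ U) {Z : V × V → V}
    (hZ : DifferentiableAt ℝ Z z) (w : V) : berwaldHor L Z z w = fderiv ℝ Z z (bet L z w)
      - (1 / 2 : ℝ) • fderiv ℝ (fderiv ℝ (fun p => (spray L p).2)) z (0, Z z) (0, w) := by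
  have h1 : HasFDerivAt (fun p : V × V =>
      ((w, (1 / 2 : ℝ) • fderiv ℝ (fun p => (spray L p).2) p (0, w)) : V × V)) _ z :=
    (hasFDerivAt_const w z).prodMk (((h.differentiableAt_fderiv_spray_snd hz).hasFDerivAt.clm_apply
      (hasFDerivAt_const ((0, w) : V × V) z)).const_smul (1 / 2 : ℝ))
  have h2 := (h1.congr_of_eventuallyEq (f₁ := fun p => bet L p w) (by
    filter_upwards [h.isOpen.mem_nhds hz] with p hp using h.bet_eq hp _)).fderiv
  have h3 : HasFDerivAt (fun p : V × V => ((0, Z p) : V × V)) _ z :=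
    (hasFDerivAt_const (0 : V) z).prodMk hZ.hasFDerivAt
  have h4 : VectorField.lieBracket ℝ (fun p => bet L p w) (fun p => gam (Z p)) z
      = (0, fderiv ℝ Z z (bet L z w)
        - (1 / 2 : ℝ) • fderiv ℝ (fderiv ℝ (fun p => (spray L p).2)) z (0, Z z) (0, w)) := by
    simp [VectorField.lieBracket, h2, h3.fderiv, gam]
  rw [berwaldHor, h4, h.verProj_vertical hz]

end IsEnergyOn

/-! ### Concurrency and the complete lift -/

/-- The Berwald part of the concurrency equations in a coordinate domain, the horizontal one being
contracted with the fundamental field. -/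
structure IsBerwaldConcurrentOn (U : Set (V × V)) (L : V × V → ℝ) (Z : V × V → V) : Prop where
  smooth : ContDiffOn ℝ ∞ Z U
  hor : ∀ z ∈ U, berwaldHor L Z z z.2 = -z.2
  ver : ∀ z ∈ U, ∀ w, berwaldVer L Z z w = 0

theorem IsEnergyOn.mono {U U' : Set (V × V)} {L : V × V → ℝ} (h : IsEnergyOn U L) (hU : U' ⊆ U)
    (ho : IsOpen U') (hc : ∀ z ∈ U', ∀ t : ℝ, 0 < t → (z.1, t • z.2) ∈ U') : IsEnergyOn U' L :=
  ⟨ho, h.smooth.mono hU, hc, fun z hz => h.homog z (hU hz), fun z hz => h.nondeg z (hU hz)⟩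

namespace IsBerwaldConcurrentOn

variable {U : Set (V × V)} {L : V × V → ℝ} {Z : V × V → V}

theorem mono {U' : Set (V × V)} (hZ : IsBerwaldConcurrentOn U L Z) (hU : U' ⊆ U) :
    IsBerwaldConcurrentOn U' L Z :=
  ⟨hZ.smooth.mono hU, fun z hz => hZ.hor z (hU hz), fun z hz => hZ.ver z (hU hz)⟩

theorem contDiffAt (hZ : IsBerwaldConcurrentOn U L Z) (h : IsEnergyOn U L) {z : V × V}
    (hz : z ∈ U) : ContDiffAt ℝ ∞ Z z :=
  hZ.smooth.contDiffAt (h.isOpen.mem_nhds hz)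

theorem differentiableAt (hZ : IsBerwaldConcurrentOn U L Z) (h : IsEnergyOn U L) {z : V × V}
    (hz : z ∈ U) : DifferentiableAt ℝ Z z :=
  (hZ.contDiffAt h hz).differentiableAt (by simp)

variable [FiniteDimensional ℝ V]

theorem fderiv_vertical (hZ : IsBerwaldConcurrentOn U L Z) (h : IsEnergyOn U L) {z : V × V}
    (hz : z ∈ U) (w : V) : fderiv ℝ Z z (0, w) = 0 := by
  rw [← h.berwaldVer_eq hz (hZ.differentiableAt h hz), hZ.ver z hz]

theorem fderiv_eq (hZ : IsBerwaldConcurrentOn U L Z) (h : IsEnergyOn U L) {z : V × V}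
    (hz : z ∈ U) (X : V × V) : fderiv ℝ Z z X = fderiv ℝ Z z (X.1, 0) := by
  have e : X = (X.1, 0) + (0, X.2) := by simp
  conv_lhs => rw [e]
  rw [map_add, hZ.fderiv_vertical h hz, add_zero]

/-- The complete lift of `Z` is an infinitesimal homothety of the energy. -/
theorem fderiv_completeLift (hZ : IsBerwaldConcurrentOn U L Z) (h : IsEnergyOn U L) {z : V × V}
    (hz : z ∈ U) : fderiv ℝ L z (Z z, fderiv ℝ Z z (z.2, 0)) = -2 * L z := by
  have h1 := hZ.hor z hz
  rw [h.berwaldHor_eq hz (hZ.differentiableAt h hz), h.fderiv_fderiv_spray_radial hz,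
    hZ.fderiv_eq h hz, h.bet_eq hz] at h1
  -- The contracted horizontal equation `h1` is precisely the second component of Z^c = βZ - γη.
  have e : ((Z z, fderiv ℝ Z z (z.2, 0)) : V × V) = bet L z (Z z) - (0, z.2) := by
    rw [h.bet_eq hz]
    refine Prod.ext (by simp) ?_
    simp only [Prod.snd_sub]
    rw [sub_eq_iff_eq_add] at h1
    rw [h1]
    abel
  rw [e, map_sub, h.fderiv_bet hz, h.euler hz]
  ring

/-- The complete lift of `Z` acts on the one-form `g(Z, η)` by the same factor as on the energy. -/
theorem fderiv_pairing_completeLift (hZ : IsBerwaldConcurrentOn U L Z) (h : IsEnergyOn U L)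
    {z : V × V} (hz : z ∈ U) :
    fderiv ℝ (fun p => fderiv ℝ L p (0, Z p)) z (Z z, fderiv ℝ Z z (z.2, 0))
      = -2 * fderiv ℝ L z (0, Z z) := by
  have hD := (h.differentiableAt_fderiv hz).hasFDerivAt
  have hdZ := (hZ.differentiableAt h hz).hasFDerivAt
  have hD2 : HasFDerivAt (fderiv ℝ Z) (fderiv ℝ (fderiv ℝ Z) z) z :=
    (((hZ.contDiffAt h hz).fderiv_right (m := ∞) (by simp)).differentiableAt (by simp)).hasFDerivAt
  have hsymm : IsSymmSndFDerivAt ℝ Z z :=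
    (hZ.contDiffAt h hz).isSymmSndFDerivAt (by simpa using WithTop.coe_le_coe.2 (le_top : (2 : ℕ∞) ≤ ⊤))
  have h1 : HasFDerivAt (fun p => fderiv ℝ L p (Z p, fderiv ℝ Z p (p.2, 0))) _ z :=
    hD.clm_apply (hdZ.prodMk (hD2.clm_apply (hasFDerivAt_snd.prodMk (hasFDerivAt_const (0 : V) z))))
  have h2 : HasFDerivAt (fun p => -2 * L p) _ z := (h.differentiableAt hz).hasFDerivAt.const_mul (-2)
  -- Z^v is applied to Z^c L = -2L; what remains is to exchange the order of the two lifts.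
  have h3 := DFunLike.congr_fun (h1.unique (h2.congr_of_eventuallyEq (by
    filter_upwards [h.isOpen.mem_nhds hz] with p hp using hZ.fderiv_completeLift h hp))) (0, Z z)
  have h4 : HasFDerivAt (fun p => fderiv ℝ Z p (0, Z z)) _ z :=
    hD2.clm_apply (hasFDerivAt_const ((0, Z z) : V × V) z)
  -- Differentiating the vanishing vertical derivative of Z along (y, 0), then using symmetry, kills
  -- the mixed second derivative. This is the vanishing of [Z^c, Z^v].
  have h5 := DFunLike.congr_fun (h4.unique ((hasFDerivAt_const (0 : V) z).congr_of_eventuallyEq (by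
    filter_upwards [h.isOpen.mem_nhds hz] with p hp using hZ.fderiv_vertical h hp _))) (z.2, 0)
  simp at h5
  rw [← hsymm] at h5
  simp [hZ.fderiv_vertical h hz, h5] at h3
  have h6 : HasFDerivAt (fun p => fderiv ℝ L p (0, Z p)) _ z :=
    hD.clm_apply ((hasFDerivAt_const (0 : V) z).prodMk hdZ)
  rw [h6.fderiv]
  simp
  rw [hZ.fderiv_eq h hz (Z z, fderiv ℝ Z z (z.2, 0)), h.hessian_symm hz]
  linarith

/-- If `g(Z, η)` vanishes near a point, then so does `Z` at that point. -/
theorem eq_zero_of_pairing (hZ : IsBerwaldConcurrentOn U L Z) (h : IsEnergyOn U L) {z : V × V}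
    (hz : z ∈ U) (h0 : ∀ᶠ p in 𝓝 z, fderiv ℝ L p (0, Z p) = 0) : Z z = 0 := by
  apply h.nondeg z hz
  intro v
  have h6 : HasFDerivAt (fun p => fderiv ℝ L p (0, Z p)) _ z :=
    (h.differentiableAt_fderiv hz).hasFDerivAt.clm_apply
      ((hasFDerivAt_const (0 : V) z).prodMk (hZ.differentiableAt h hz).hasFDerivAt)
  -- Z does not vary along the fibre, so the derivative along (0, v) is g(v, Z) alone.
  have h7 := DFunLike.congr_fun (h6.unique ((hasFDerivAt_const (0 : ℝ) z).congr_of_eventuallyEq h0))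
    (0, v)
  have e0 : ((0, (0 : V)) : V × V) = 0 := rfl
  simp [hZ.fderiv_vertical h hz, e0] at h7
  rw [h.hessian_symm hz, h7]

end IsBerwaldConcurrentOn

/-! ### The contradiction in coordinates -/

/-- A nowhere vanishing field cannot satisfy the Berwald concurrency equations both for
`L = f ^ 2 / 2` and for the energy of the Matsumoto change of `f`. -/
theorem false_of_berwaldConcurrent_matsumoto [FiniteDimensional ℝ V] {U : Set (V × V)}
    {f L L' : V × V → ℝ} {Z : V × V → V} (hne : U.Nonempty) (hslit : ∀ z ∈ U, z.2 ≠ 0)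
    (hf : ContDiffOn ℝ ∞ f U) (hfL : ∀ z, L z = f z ^ 2 / 2)
    (hlt : ∀ z ∈ U, fderiv ℝ L z (0, Z z) < f z)
    (hL' : ∀ z ∈ U, L' z = (f z ^ 2 / (f z - fderiv ℝ L z (0, Z z))) ^ 2 / 2)
    (hL : IsEnergyOn U L) (hLL' : IsEnergyOn U L') (hZ : IsBerwaldConcurrentOn U L Z)
    (hZ' : IsBerwaldConcurrentOn U L' Z) (hZ0 : ∀ z ∈ U, Z z ≠ 0) : False := by
  have hP : ∀ z ∈ U, f z ≠ 0 → fderiv ℝ L z (0, Z z) = 0 := by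
    intro z hz hfz
    have hdf := ((hf.contDiffAt (hL.isOpen.mem_nhds hz)).differentiableAt (by simp)).hasFDerivAt
    have hdP : HasFDerivAt (fun p => fderiv ℝ L p (0, Z p))
        (fderiv ℝ (fun p => fderiv ℝ L p (0, Z p)) z) z :=
      DifferentiableAt.hasFDerivAt ((hL.differentiableAt_fderiv hz).clm_apply
        ((differentiableAt_const (0 : V)).prodMk (hZ.differentiableAt hL hz)))
    have h1 := hZ.fderiv_completeLift hL hz
    have h2 := hZ'.fderiv_completeLift hLL' hz
    have h3 := hZ.fderiv_pairing_completeLift hL hz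
    have hpos : f z - fderiv ℝ L z (0, Z z) ≠ 0 := (sub_pos.2 (hlt z hz)).ne'
    set X : V × V := (Z z, fderiv ℝ Z z (z.2, 0))
    have hLd : HasFDerivAt (fun p => 2 * L p) _ z := (hL.differentiableAt hz).hasFDerivAt.const_mul 2
    have hL2 := DFunLike.congr_fun (hLd.unique ((hdf.pow 2).congr_of_eventuallyEq
      (Eventually.of_forall fun p => by simp [hfL]; ring))) X
    -- The defining relation with denominators cleared: F̂²(F - Φ)² = F⁴.
    have hM : HasFDerivAt
        (fun p => 2 * L' p * (f p - fderiv ℝ L p (0, Z p)) ^ 2) _ z :=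
      ((hLL'.differentiableAt hz).hasFDerivAt.const_mul 2).mul ((hdf.sub hdP).pow 2)
    have hM2 := DFunLike.congr_fun (hM.unique ((hdf.pow 4).congr_of_eventuallyEq (by
      filter_upwards [hL.isOpen.mem_nhds hz] with p hp
      have hp0 : f p - fderiv ℝ L p (0, Z p) ≠ 0 := (sub_pos.2 (hlt p hp)).ne'
      rw [hL' p hp]
      field_simp))) X
    simp [h1, h2, h3, hfL z, hL' z hz] at hL2 hM2
    set P := fderiv ℝ L z (0, Z z)
    have hfX : fderiv ℝ f z X = -f z := by
      apply mul_left_cancel₀ hfz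
      linarith
    -- With XF = -F and XΦ = -2Φ, the relation reduces to 2Φ - F = -(F - Φ), that is Φ = 0.
    rw [hfX] at hM2
    field_simp at hM2
    linarith
  obtain ⟨z, hz, hfz⟩ : ∃ z ∈ U, f z ≠ 0 := by
    by_contra! hall
    obtain ⟨z, hz⟩ := hne
    -- If F vanished on all of U, the Hessian of L would too, and nondegeneracy applied to y itself
    -- would give y = 0.
    apply hslit z hz
    apply hL.nondeg z hz
    intro v
    have h0 : L =ᶠ[𝓝 z] fun _ => (0 : ℝ) := by
      filter_upwards [hL.isOpen.mem_nhds hz] with p hp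
      simp [hfL, hall p hp]
    have h1 : fderiv ℝ (fderiv ℝ L) z = 0 := by
      rw [h0.fderiv.fderiv_eq]
      simp
    simp [h1]
  refine hZ0 z hz (hZ.eq_zero_of_pairing hL hz ?_)
  filter_upwards [hL.isOpen.mem_nhds hz,
    (hf.continuousOn.continuousAt (hL.isOpen.mem_nhds hz)).eventually_ne hfz] with p hp hfp
  exact hP p hp hfp

end ChartCalculus

/-! ### Transfer between the manifold and a chart -/

/-- A mixed second derivative along two directions is a value of the Hessian. -/
theorem deriv_deriv_line {E : Type*} [NormedAddCommGroup E] [NormedSpace ℝ E] {L : E → ℝ} {z : E}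
    (hL : ContDiffAt ℝ ∞ L z) (a b : E) :
    deriv (fun s : ℝ => deriv (fun t : ℝ => L (z + s • a + t • b)) 0) 0
      = fderiv ℝ (fderiv ℝ L) z a b := by
  have hline : ∀ p q : E, HasDerivAt (fun t : ℝ => p + t • q) q 0 := fun p q => by
    simpa using ((hasDerivAt_id (0 : ℝ)).smul_const q).const_add p
  have h1 : (fun s : ℝ => deriv (fun t : ℝ => L (z + s • a + t • b)) 0)
      =ᶠ[𝓝 0] fun s : ℝ => fderiv ℝ L (z + s • a) b := by
    have hc : Tendsto (fun s : ℝ => z + s • a) (𝓝 0) (𝓝 z) := by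
      simpa using (hline z a).continuousAt.tendsto
    filter_upwards [hc.eventually ((hL.of_le (m := 1) (by simp)).eventually (by simp))] with s hs
    have h2 : HasFDerivAt L (fderiv ℝ L (z + s • a)) (z + s • a + (0 : ℝ) • b) := by
      rw [zero_smul, add_zero]
      exact (hs.differentiableAt (by simp)).hasFDerivAt
    have h5 : HasDerivAt (fun t : ℝ => L (z + s • a + t • b)) (fderiv ℝ L (z + s • a) b) 0 :=
      h2.comp_hasDerivAt (0 : ℝ) (hline _ b)
    exact h5.deriv
  have h3 : HasFDerivAt (fun p => fderiv ℝ L p b) ((fderiv ℝ (fderiv ℝ L) z).flip b)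
      (z + (0 : ℝ) • a) := by
    rw [zero_smul, add_zero]
    simpa using ((hL.fderiv_right (m := ∞) (by simp)).differentiableAt (by simp)).hasFDerivAt.clm_apply
      (hasFDerivAt_const b z)
  have h4 := HasFDerivAt.comp_hasDerivAt (f := fun t : ℝ => z + t • a) (0 : ℝ) h3 (hline z a)
  rw [h1.deriv_eq]
  exact h4.deriv

theorem mdifferentiable_of_mem_maximalAtlas {n : ℕ} {M : Type*} [TopologicalSpace M]
    [ChartedSpace (EuclideanSpace ℝ (Fin n)) M]
    {e : OpenPartialHomeomorph M (EuclideanSpace ℝ (Fin n))}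
    (he : e ∈ IsManifold.maximalAtlas (𝓡 n) ∞ M) : e.MDifferentiable (𝓡 n) (𝓡 n) :=
  ⟨(contMDiffOn_of_mem_maximalAtlas he).mdifferentiableOn (by simp),
    (contMDiffOn_symm_of_mem_maximalAtlas he).mdifferentiableOn (by simp)⟩

section ChartTransfer

variable {n : ℕ} {M : Type*} [TopologicalSpace M] [ChartedSpace (EuclideanSpace ℝ (Fin n)) M]
  [IsManifold (𝓡 n) ∞ M] {e : OpenPartialHomeomorph M (EuclideanSpace ℝ (Fin n))}

/-- The coordinate domain of `D` in the chart of `TM` induced by `e`. -/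
def chartDomain (e : OpenPartialHomeomorph M (EuclideanSpace ℝ (Fin n)))
    (D : Set (TangentBundle (𝓡 n) M)) :
    Set (EuclideanSpace ℝ (Fin n) × EuclideanSpace ℝ (Fin n)) :=
  {z | z.1 ∈ e.target ∧ chartPoint e z ∈ D}

/-- Through this identification `chartPoint e` is the tangent map of `e.symm`, which is how it
inherits smoothness. -/
theorem contMDiff_tangentBundle_mk : ContMDiff
    𝓘(ℝ, EuclideanSpace ℝ (Fin n) × EuclideanSpace ℝ (Fin n)) (𝓡 n).tangent ∞
    (fun z : EuclideanSpace ℝ (Fin n) × EuclideanSpace ℝ (Fin n) =>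
      (⟨z.1, z.2⟩ : TangentBundle (𝓡 n) (EuclideanSpace ℝ (Fin n)))) := by
  intro z
  rw [Bundle.contMDiffAt_totalSpace]
  refine ⟨contDiff_fst.contMDiff z, ?_⟩
  simpa using contDiff_snd.contMDiff z

/-- The tangent map of a function that is smooth on an open set is smooth there. -/
theorem contMDiffOn_tangentMap {N N' : Type*} [TopologicalSpace N]
    [ChartedSpace (EuclideanSpace ℝ (Fin n)) N] [IsManifold (𝓡 n) ∞ N] [TopologicalSpace N']
    [ChartedSpace (EuclideanSpace ℝ (Fin n)) N'] [IsManifold (𝓡 n) ∞ N'] {f : N → N'} {s : Set N}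
    (hs : IsOpen s) (hf : ContMDiffOn (𝓡 n) (𝓡 n) ∞ f s) :
    ContMDiffOn (𝓡 n).tangent (𝓡 n).tangent ∞ (tangentMap (𝓡 n) (𝓡 n) f)
      {p : TangentBundle (𝓡 n) N | p.1 ∈ s} := by
  have h1 := hf.contMDiffOn_tangentMapWithin (m := ∞) (by simp) hs.uniqueMDiffOn
  refine h1.congr fun p hp => ?_
  exact (tangentMapWithin_eq_tangentMap (hs.uniqueMDiffOn _ hp)
    ((hf.contMDiffAt (hs.mem_nhds hp)).mdifferentiableAt (by simp))).symm

theorem contMDiffOn_chartPoint (he : e ∈ IsManifold.maximalAtlas (𝓡 n) ∞ M) :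
    ContMDiffOn 𝓘(ℝ, EuclideanSpace ℝ (Fin n) × EuclideanSpace ℝ (Fin n)) (𝓡 n).tangent ∞
      (chartPoint e) (Prod.fst ⁻¹' e.target) :=
  (contMDiffOn_tangentMap e.open_target (contMDiffOn_symm_of_mem_maximalAtlas he)).comp
    contMDiff_tangentBundle_mk.contMDiffOn fun _ hz => hz

theorem isOpen_chartDomain (he : e ∈ IsManifold.maximalAtlas (𝓡 n) ∞ M)
    {D : Set (TangentBundle (𝓡 n) M)} (hD : IsOpen D) : IsOpen (chartDomain e D) :=
  (contMDiffOn_chartPoint he).continuousOn.isOpen_inter_preimage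
    (e.open_target.preimage continuous_fst) hD

theorem contDiffOn_comp_chartPoint (he : e ∈ IsManifold.maximalAtlas (𝓡 n) ∞ M)
    {D : Set (TangentBundle (𝓡 n) M)} {F : TangentBundle (𝓡 n) M → ℝ}
    (hF : ContMDiffOn (𝓡 n).tangent 𝓘(ℝ, ℝ) ∞ F D) :
    ContDiffOn ℝ ∞ (fun z => F (chartPoint e z)) (chartDomain e D) :=
  (hF.comp ((contMDiffOn_chartPoint he).mono fun _ hz => hz.1) fun _ hz => hz.2).contDiffOn

theorem contDiffOn_chartField (he : e ∈ IsManifold.maximalAtlas (𝓡 n) ∞ M)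
    {D : Set (TangentBundle (𝓡 n) M)} {φ : ∀ p : TangentBundle (𝓡 n) M, TangentSpace (𝓡 n) p.1}
    (hφ : ContMDiffOn (𝓡 n).tangent (𝓡 n).tangent ∞
      (fun p => (⟨p.1, φ p⟩ : TangentBundle (𝓡 n) M)) D) :
    ContDiffOn ℝ ∞ (chartField e φ) (chartDomain e D) := by
  have h1 := hφ.comp ((contMDiffOn_chartPoint he).mono fun z (hz : z ∈ chartDomain e D) => hz.1)
    fun z hz => hz.2
  have h2 := (contMDiffOn_tangentMap e.open_source (contMDiffOn_of_mem_maximalAtlas he)).comp h1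
    fun z hz => e.map_target hz.1
  exact ((contMDiff_snd_tangentBundle_modelSpace (EuclideanSpace ℝ (Fin n)) (𝓡 n)).comp_contMDiffOn
    h2).contDiffOn

/-- The differential of the inverse chart, with values in the tangent space at a point of the chart
of `TM`. -/
def chartVec (e : OpenPartialHomeomorph M (EuclideanSpace ℝ (Fin n)))
    (z : EuclideanSpace ℝ (Fin n) × EuclideanSpace ℝ (Fin n)) :
    EuclideanSpace ℝ (Fin n) →L[ℝ] TangentSpace (𝓡 n) (chartPoint e z).1 :=
  mfderiv (𝓡 n) (𝓡 n) e.symm z.1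

theorem chartPoint_snd (z : EuclideanSpace ℝ (Fin n) × EuclideanSpace ℝ (Fin n)) :
    (chartPoint e z).2 = chartVec e z z.2 := rfl

theorem chartVec_chartField (he : e ∈ IsManifold.maximalAtlas (𝓡 n) ∞ M)
    {z : EuclideanSpace ℝ (Fin n) × EuclideanSpace ℝ (Fin n)} (hz : z.1 ∈ e.target)
    (φ : ∀ p : TangentBundle (𝓡 n) M, TangentSpace (𝓡 n) p.1) :
    chartVec e z (chartField e φ z) = φ (chartPoint e z) := by
  have h1 := (mdifferentiable_of_mem_maximalAtlas he).symm_comp_deriv (e.map_target hz)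
  rw [e.right_inv hz] at h1
  exact DFunLike.congr_fun h1 (φ (chartPoint e z))

theorem chartVec_injective (he : e ∈ IsManifold.maximalAtlas (𝓡 n) ∞ M)
    {z : EuclideanSpace ℝ (Fin n) × EuclideanSpace ℝ (Fin n)} (hz : z.1 ∈ e.target) :
    Function.Injective (chartVec e z) :=
  Function.LeftInverse.injective (g := mfderiv (𝓡 n) (𝓡 n) e (e.symm z.1)) fun v =>
    DFunLike.congr_fun ((mdifferentiable_of_mem_maximalAtlas he).comp_symm_deriv hz) v

theorem chartVec_surjective (he : e ∈ IsManifold.maximalAtlas (𝓡 n) ∞ M)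
    {z : EuclideanSpace ℝ (Fin n) × EuclideanSpace ℝ (Fin n)} (hz : z.1 ∈ e.target) :
    Function.Surjective (chartVec e z) := by
  have h1 := (mdifferentiable_of_mem_maximalAtlas he).symm_comp_deriv (e.map_target hz)
  rw [e.right_inv hz] at h1
  exact fun v => ⟨mfderiv (𝓡 n) (𝓡 n) e (e.symm z.1) v, DFunLike.congr_fun h1 v⟩

theorem chartPoint_smul (z : EuclideanSpace ℝ (Fin n) × EuclideanSpace ℝ (Fin n)) (t : ℝ) :
    chartPoint e (z.1, t • z.2) = scale t (chartPoint e z) :=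
  Bundle.TotalSpace.ext rfl (heq_of_eq ((chartVec e z).map_smul t z.2))

/-- Linearity on each fibre lets fibre derivatives on the manifold be read as vertical derivatives
in the chart. -/
theorem chartPoint_vertical (x y w : EuclideanSpace ℝ (Fin n)) :
    chartPoint e (x, y + w)
      = ⟨(chartPoint e (x, y)).1, (chartPoint e (x, y)).2 + chartVec e (x, y) w⟩ :=
  Bundle.TotalSpace.ext rfl (heq_of_eq ((chartVec e (x, y)).map_add y w))

theorem chartDomain_conic {D : Set (TangentBundle (𝓡 n) M)}
    (hD : ∀ p ∈ D, ∀ t : ℝ, 0 < t → scale t p ∈ D) :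
    ∀ z ∈ chartDomain e D, ∀ t : ℝ, 0 < t → (z.1, t • z.2) ∈ chartDomain e D :=
  fun z hz t ht => ⟨hz.1, by rw [chartPoint_smul]; exact hD _ hz.2 t ht⟩

/-- The metric tensor in coordinates. -/
theorem fibreMetric_chartPoint {F : TangentBundle (𝓡 n) M → ℝ}
    {z : EuclideanSpace ℝ (Fin n) × EuclideanSpace ℝ (Fin n)}
    (hF : ContDiffAt ℝ ∞ (chartEnergy e F) z) (u v : EuclideanSpace ℝ (Fin n)) :
    fibreMetric F (chartPoint e z) (chartVec e z u) (chartVec e z v)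
      = fderiv ℝ (fderiv ℝ (chartEnergy e F)) z (0, u) (0, v) := by
  have h1 : ∀ s t : ℝ, F ⟨(chartPoint e z).1, (chartPoint e z).2
      + s • chartVec e z u + t • chartVec e z v⟩ ^ 2 / 2
      = chartEnergy e F (z + s • (0, u) + t • (0, v)) := by
    intro s t
    have h3 : z + s • ((0, u) : EuclideanSpace ℝ (Fin n) × EuclideanSpace ℝ (Fin n)) + t • (0, v)
        = (z.1, z.2 + (s • u + t • v)) := by
      ext <;> simp [add_assoc]
    rw [h3, chartEnergy, chartPoint_vertical, map_add, map_smul, map_smul, add_assoc]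
  rw [← deriv_deriv_line hF, fibreMetric]
  simp_rw [h1]

theorem contDiffOn_chartEnergy (he : e ∈ IsManifold.maximalAtlas (𝓡 n) ∞ M)
    {D : Set (TangentBundle (𝓡 n) M)} {F : TangentBundle (𝓡 n) M → ℝ}
    (hF : ContMDiffOn (𝓡 n).tangent 𝓘(ℝ, ℝ) ∞ F D) :
    ContDiffOn ℝ ∞ (chartEnergy e F) (chartDomain e D) :=
  ((contDiffOn_comp_chartPoint he hF).pow 2).div_const 2

theorem IsConicPseudoFinsler.isEnergyOn {D : Set (TangentBundle (𝓡 n) M)}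
    {F : TangentBundle (𝓡 n) M → ℝ} (hF : IsConicPseudoFinsler D F)
    (he : e ∈ IsManifold.maximalAtlas (𝓡 n) ∞ M) :
    IsEnergyOn (chartDomain e D) (chartEnergy e F) where
  isOpen := isOpen_chartDomain he hF.isOpen
  smooth := contDiffOn_chartEnergy he hF.smooth
  conic := chartDomain_conic hF.conic
  homog z hz t ht := by
    rw [chartEnergy, chartPoint_smul, hF.homog _ hz.2 t ht, chartEnergy]
    ring
  nondeg z hz u hu := by
    have hs := (contDiffOn_chartEnergy he hF.smooth).contDiffAt
      ((isOpen_chartDomain he hF.isOpen).mem_nhds hz)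
    -- Injectivity of the chart differential brings u back to coordinates; its surjectivity makes
    -- coordinate test vectors sufficient.
    refine (map_eq_zero_iff _ (chartVec_injective he hz.1)).1 (hF.nondeg _ hz.2 _ fun w => ?_)
    obtain ⟨v, rfl⟩ := chartVec_surjective he hz.1 w
    rw [fibreMetric_chartPoint hs, hu]

theorem IsConcurrent.isBerwaldConcurrentOn {D : Set (TangentBundle (𝓡 n) M)}
    {F : TangentBundle (𝓡 n) M → ℝ} {φ : ∀ p : TangentBundle (𝓡 n) M, TangentSpace (𝓡 n) p.1}
    (hφ : IsConcurrent D F φ) (he : e ∈ IsManifold.maximalAtlas (𝓡 n) ∞ M) :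
    IsBerwaldConcurrentOn (chartDomain e D) (chartEnergy e F) (chartField e φ) where
  smooth := contDiffOn_chartField he hφ.smooth
  hor z hz := (hφ.eqns e he z hz.1 hz.2 z.2).2.1
  ver z hz w := (hφ.eqns e he z hz.1 hz.2 w).2.2.2

/-- The one-form `g(φ, η)` in coordinates. -/
theorem IsConicPseudoFinsler.assocForm_chartPoint {D : Set (TangentBundle (𝓡 n) M)}
    {F : TangentBundle (𝓡 n) M → ℝ} (hF : IsConicPseudoFinsler D F)
    (he : e ∈ IsManifold.maximalAtlas (𝓡 n) ∞ M)
    (φ : ∀ p : TangentBundle (𝓡 n) M, TangentSpace (𝓡 n) p.1)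
    {z : EuclideanSpace ℝ (Fin n) × EuclideanSpace ℝ (Fin n)} (hz : z ∈ chartDomain e D) :
    assocForm F φ (chartPoint e z) = fderiv ℝ (chartEnergy e F) z (0, chartField e φ z) := by
  have h := hF.isEnergyOn he
  -- Euler's relation trades the Hessian paired with y for a first derivative, which exhibits Φ as
  -- Z^v L.
  rw [← h.hessian_radial_vertical hz, ← fibreMetric_chartPoint (h.contDiffAt hz),
    chartVec_chartField he hz.1, ← chartPoint_snd, assocForm]

end ChartTransfer
end FinslerGeom
end

theorem mainTheorem10 {n : ℕ} {M : Type*} [TopologicalSpace M] [T2Space M] [ParacompactSpace M]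
    [ChartedSpace (EuclideanSpace ℝ (Fin n)) M] [IsManifold (𝓡 n) ∞ M]
    (A : Set (TangentBundle (𝓡 n) M)) (F : TangentBundle (𝓡 n) M → ℝ)
    (hF : FinslerGeom.IsConicPseudoFinsler A F)
    (φ : ∀ p : TangentBundle (𝓡 n) M, TangentSpace (𝓡 n) p.1)
    (hφ : FinslerGeom.IsConcurrent A F φ)
    (hFhat : FinslerGeom.IsConicPseudoFinsler (FinslerGeom.matsumotoDomain A F φ)
      (FinslerGeom.matsumotoChange F φ)) :
    ¬ FinslerGeom.IsConcurrent (FinslerGeom.matsumotoDomain A F φ)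
      (FinslerGeom.matsumotoChange F φ) φ := by
  intro hφ'
  obtain ⟨p, hp⟩ := hFhat.nonempty
  -- The obstruction is local, so a single chart around one point of the domain suffices.
  let e := chartAt (EuclideanSpace ℝ (Fin n)) p.1
  have he : e ∈ IsManifold.maximalAtlas (𝓡 n) ∞ M := IsManifold.chart_mem_maximalAtlas p.1
  have hsrc : p.1 ∈ e.source := mem_chart_source _ p.1
  let z : EuclideanSpace ℝ (Fin n) × EuclideanSpace ℝ (Fin n) :=
    (e p.1, mfderiv (𝓡 n) (𝓡 n) e p.1 p.2)
  have hzp : FinslerGeom.chartPoint e z = p := by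
    have h1 : mfderiv (𝓡 n) (𝓡 n) e.symm (e p.1) (mfderiv (𝓡 n) (𝓡 n) e p.1 p.2) = p.2 :=
      DFunLike.congr_fun
        ((FinslerGeom.mdifferentiable_of_mem_maximalAtlas he).symm_comp_deriv hsrc) p.2
    exact Bundle.TotalSpace.ext (e.left_inv hsrc) (heq_of_eq h1)
  have hsub : FinslerGeom.chartDomain e (FinslerGeom.matsumotoDomain A F φ)
      ⊆ FinslerGeom.chartDomain e A := fun z hz => ⟨hz.1, hz.2.1⟩
  have hassoc := fun z hz => hF.assocForm_chartPoint he φ (z := z) (hsub hz)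
  refine FinslerGeom.false_of_berwaldConcurrent_matsumoto
    (U := FinslerGeom.chartDomain e (FinslerGeom.matsumotoDomain A F φ))
    (f := fun z => F (FinslerGeom.chartPoint e z)) (L := FinslerGeom.chartEnergy e F)
    (L' := FinslerGeom.chartEnergy e (FinslerGeom.matsumotoChange F φ))
    (Z := FinslerGeom.chartField e φ) ⟨z, e.map_source hsrc, hzp.symm ▸ hp⟩ ?_
    (FinslerGeom.contDiffOn_comp_chartPoint he (hF.smooth.mono fun p hp => hp.1))
    (fun _ => rfl) ?_ ?_
    -- The data of F are restricted to the smaller domain {F > Φ}, so that both structures are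
    -- compared on the same open conic set.
    ((hF.isEnergyOn he).mono hsub (FinslerGeom.isOpen_chartDomain he hFhat.isOpen)
      (FinslerGeom.chartDomain_conic hFhat.conic))
    (hFhat.isEnergyOn he) ((hφ.isBerwaldConcurrentOn he).mono hsub)
    (hφ'.isBerwaldConcurrentOn he) ?_
  · intro z hz h0
    apply hFhat.subset_slit hz.2
    rw [FinslerGeom.chartPoint_snd, h0, map_zero]
  · intro z hz
    rw [← hassoc z hz]
    exact hz.2.2
  · intro z hz
    rw [← hassoc z hz]
    rfl
  · intro z hz h0
    apply hφ'.ne_zero _ hz.2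
    rw [← FinslerGeom.chartVec_chartField he hz.1 φ, h0, map_zero]
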